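/- Let $(X,d_X)$ be a metric space, and let $\upsilon$ be a non-empty urn over $X$, i.e. a finite multiset $\upsilon\colon X\to\mathbb{N}$ (a function with finite, non-empty support $S=\mathrm{supp}(\upsilon)$), of size $L=\sum_x\upsilon(x)$. Write $\mathcal{D}(X)$ for the set of finitely supported probability distributions on $X$, with the Kantorovich distance $d(\omega,\omega')=\inf_\tau\sum_{x,y}\tau(x,y)\,d_X(x,y)$, where $\tau$ ranges over the couplings of $\omega,\omega'$ in $\mathcal{D}(X\times X)$. For a non-empty multiset $\varphi$ let $\mathrm{Flrn}(\varphi)\in\mathcal{D}(X)$ be its normalisation $x\mapsto\varphi(x)/\|\varphi\|$, where $\|\varphi\|=\sum_x\varphi(x)$. For $K\geq 1$ let $\mathrm{pl}[K](\upsilon)$ be the Pólya distribution on multisets $\varphi$ of size $K$ with $\mathrm{supp}(\varphi)\subseteq S$: \[ \mathrm{pl}[K](\upsilon)(\varphi)=\frac{\prod_{x\in S}\left(\!\binom{\upsilon(x)}{\varphi(x)}\!\right)}{\left(\!\binom{L}{K}\!\right)},\qquad \left(\!\binom{n}{m}\!\right)=\binom{n+m-1}{m}. \] Let $\mathrm{Dir}(\upsilon)$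 be the Dirichlet distribution on the simplex $\mathcal{D}(S)\subseteq\mathcal{D}(X)$, i.e. the probability measure with density \[ \mathrm{Dir}(\upsilon)(\omega)=\frac{\Gamma(L)}{\prod_{x\in S}\Gamma(\upsilon(x))}\prod_{x\in S}\omega(x)^{\upsilon(x)-1} \] with respect to the Lebesgue measure $\mathrm{d}\omega$ in the coordinates $(\omega(x))_{x\in S,\,x\neq x_0}$, for any choice of $x_0\in S$. Then $\omega\mapsto d(\omega,\mathrm{Flrn}(\upsilon))$ is integrable with respect to $\mathrm{Dir}(\upsilon)$, the following limit exists, and \[ \lim_{K\to\infty}\ \sum_{\varphi}\mathrm{pl}[K](\upsilon)(\varphi)\cdot d\big(\mathrm{Flrn}(\varphi),\mathrm{Flrn}(\upsilon)\big)\;=\;\int_{\omega\in\mathcal{D}(S)}\mathrm{Dir}(\upsilon)(\omega)\cdot d\big(\omega,\mathrm{Flrn}(\upsilon)\big)\,\mathrm{d}\omega\;=\;\mathrm{Dir}(\upsilon)\models d\big(-,\mathrm{Flrn}(\upsilon)\big), \] where the last expression is the expected value of $d(-,\mathrm{Flrn}(\upsilon))$ under the measure $\mathrm{Dir}(\upsilon)$.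 -/

import Mathlib

open Filter Topology MeasureTheory Convexity

/-!
Distributions with finite support on `X` are elements of `StdSimplex ℝ X`; multisets (urns, draws)
over `X` are finitely supported functions `X →₀ ℕ`.
-/

namespace Urn

noncomputable section

variable {X : Type*}

/-- The validity (expected value) `ω ⊨ p = ∑ x, ω(x) · p(x)` of an observation `p`. -/
def validity (ω : StdSimplex ℝ X) (p : X → ℝ) : ℝ :=
  ω.weights.sum fun x r => r * p x

/-- The couplings of two distributions: joint distributions with these marginals. -/
abbrev Coupling (ω ω' : StdSimplex ℝ X) : Type _ :=
  {τ : StdSimplex ℝ (X × X) // τ.map Prod.fst = ω ∧ τ.map Prod.snd = ω'}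

/-- The Kantorovich distance: the infimum of `τ ⊨ d_X` over all couplings `τ`. -/
def kantorovich [MetricSpace X] (ω ω' : StdSimplex ℝ X) : ℝ :=
  ⨅ τ : Coupling ω ω', validity τ.1 fun z => dist z.1 z.2

/-- The size of a multiset: its number of elements, with multiplicities. -/
def size (φ : X →₀ ℕ) : ℕ := φ.sum fun _ n => n

lemma size_pos {φ : X →₀ ℕ} (h : φ ≠ 0) : 0 < size φ := by
  obtain ⟨x, hx⟩ := Finsupp.ne_iff.1 h
  have hx' : x ∈ φ.support := by simpa using hx
  exact lt_of_lt_of_le (Nat.pos_of_ne_zero (by simpa using hx))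
    (Finset.single_le_sum (f := fun x => φ x) (fun _ _ => Nat.zero_le _) hx')

/-- The set of multisets over `X` of size `K`. -/
abbrev Multi (K : ℕ) (X : Type*) : Type _ := {φ : X →₀ ℕ // size φ = K}

lemma Multi.ne_zero {K : ℕ} (φ : Multi (K + 1) X) : φ.1 ≠ 0 := by
  intro h
  have h2 := φ.2
  rw [h] at h2
  simp [size] at h2

/-- Frequentist learning: the normalisation of a non-empty multiset to a distribution. -/
def flrn (φ : X →₀ ℕ) (hφ : φ ≠ 0) : StdSimplex ℝ X where
  weights := φ.mapRange (fun n : ℕ => (n : ℝ) / (size φ : ℝ)) (by simp)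
  nonneg := fun x => by
    simp only [Finsupp.coe_zero, Pi.zero_apply, Finsupp.mapRange_apply]
    positivity
  total := by
    rw [Finsupp.sum_mapRange_index (by simp)]
    have h : (size φ : ℝ) ≠ 0 := by exact_mod_cast (size_pos hφ).ne'
    rw [Finsupp.sum, ← Finset.sum_div, div_eq_one_iff_eq h, size, Finsupp.sum]
    push_cast
    rfl

/-! ### Pólya draws -/

open scoped Classical in
/-- The draws `φ` of size `K` with `supp(φ) ⊆ supp(υ)`. -/
def draws (υ : X →₀ ℕ) (K : ℕ) : Finset (Multi K X) :=
  (υ.support.finsuppAntidiag K).subtype fun φ => size φ = K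

open scoped Classical in
lemma mem_draws (υ : X →₀ ℕ) (K : ℕ) (φ : Multi K X) :
    φ ∈ draws υ K ↔ φ.1.support ⊆ υ.support := by
  rw [draws, Finset.mem_subtype, Finset.mem_finsuppAntidiag']
  exact ⟨fun h => h.2, fun h => ⟨φ.2, h⟩⟩

/-- The probability `((υ over φ)) / ((L over K))` of drawing `φ` from an urn `υ` of size `L`,
in terms of multichoose coefficients. -/
def polyaWeight (υ : X →₀ ℕ) (K : ℕ) (φ : Multi K X) : ℝ :=
  (∏ x ∈ υ.support, (Nat.multichoose (υ x) (φ.1 x) : ℝ)) / (Nat.multichoose (size υ) K : ℝ)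

lemma coeff_invOneSubPow (d n : ℕ) :
    PowerSeries.coeff n (PowerSeries.invOneSubPow ℤ d).val = (Nat.multichoose d n : ℤ) := by
  rcases d with _ | d
  · rcases n with _ | n
    · simp [PowerSeries.invOneSubPow_zero]
    · simp [PowerSeries.invOneSubPow_zero, PowerSeries.coeff_one]
  · rw [PowerSeries.invOneSubPow_val_succ_eq_mk_add_choose, PowerSeries.coeff_mk,
      Nat.multichoose_eq]
    congr 1
    rw [show d + 1 + n - 1 = d + n by omega]
    exact Nat.choose_symm_add

open scoped Classical in
lemma sum_prod_multichoose (υ : X →₀ ℕ) (K : ℕ) :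
    ∑ φ ∈ υ.support.finsuppAntidiag K, ∏ x ∈ υ.support, Nat.multichoose (υ x) (φ x)
      = Nat.multichoose (size υ) K := by
  have key : ∏ x ∈ υ.support, (PowerSeries.invOneSubPow ℤ (υ x)).val
      = (PowerSeries.invOneSubPow ℤ (size υ)).val := by
    rw [size, Finsupp.sum]
    induction υ.support using Finset.induction_on with
    | empty => simp [PowerSeries.invOneSubPow_zero]
    | insert a s ha ih =>
      rw [Finset.prod_insert ha, Finset.sum_insert ha, PowerSeries.invOneSubPow_add, ih]
      rfl
  have h := congrArg (PowerSeries.coeff K) key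
  rw [PowerSeries.coeff_prod, coeff_invOneSubPow] at h
  simp only [coeff_invOneSubPow] at h
  exact_mod_cast h

lemma multichoose_pos {d : ℕ} (h : 0 < d) (n : ℕ) : 0 < Nat.multichoose d n := by
  rw [Nat.multichoose_eq]
  exact Nat.choose_pos (by omega)

lemma sum_polyaWeight (υ : X →₀ ℕ) (hυ : υ ≠ 0) (K : ℕ) :
    ∑ φ ∈ draws υ K, polyaWeight υ K φ = 1 := by
  classical
  have hpos := multichoose_pos (size_pos hυ) K
  have hne : (Nat.multichoose (size υ) K : ℝ) ≠ 0 := by exact_mod_cast hpos.ne'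
  simp only [polyaWeight]
  rw [← Finset.sum_div, div_eq_one_iff_eq hne, ← sum_prod_multichoose υ K]
  push_cast
  rw [draws]
  refine Finset.sum_subtype_of_mem
    (f := fun φ : X →₀ ℕ => ∏ x ∈ υ.support, (Nat.multichoose (υ x) (φ x) : ℝ)) ?_ |>.trans ?_
  · intro φ hφ
    exact (Finset.mem_finsuppAntidiag'.1 hφ).1
  · rfl

open scoped Classical in
/-- The Pólya distribution on draws of size `K` from the non-empty urn `υ`. -/
def polya (υ : X →₀ ℕ) (hυ : υ ≠ 0) (K : ℕ) : StdSimplex ℝ (Multi K X) where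
  weights := Finsupp.indicator (draws υ K) fun φ _ => polyaWeight υ K φ
  nonneg := fun φ => by
    simp only [Finsupp.coe_zero, Pi.zero_apply, Finsupp.indicator_apply]
    split_ifs
    · exact div_nonneg (Finset.prod_nonneg fun _ _ => Nat.cast_nonneg _) (Nat.cast_nonneg _)
    · exact le_rfl
  total := by
    rw [Finsupp.sum_of_support_subset _ (Finsupp.support_indicator_subset _ _) _ (by simp),
      ← sum_polyaWeight υ hυ K]
    exact Finset.sum_congr rfl fun φ hφ => by simp [Finsupp.indicator_apply, hφ]

/-! ### The Dirichlet distribution -/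

/-- The σ-algebra on distributions that is generated by the evaluations `ω ↦ ω(x)`. -/
instance instMeasurableSpaceStdSimplex : MeasurableSpace (StdSimplex ℝ X) :=
  MeasurableSpace.comap (fun ω x => ω.weights x) (MeasurableSpace.pi (X := fun _ : X => ℝ))

/-- The full-dimensional simplex `{t | t ≥ 0, ∑ x, t x ≤ 1}` in `ℝ^T`. -/
def coordSimplex (T : Finset X) : Set (T → ℝ) := {t | (∀ x, 0 ≤ t x) ∧ ∑ x, t x ≤ 1}

/-- The distribution with probability `t x` for `x ∈ T` and the remaining probability
`1 - ∑ x, t x` for `x₀`. -/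
def ofCoords (x₀ : X) (T : Finset X) (t : coordSimplex T) : StdSimplex ℝ X where
  weights := ∑ x : T, Finsupp.single (x : X) (t.1 x) + Finsupp.single x₀ (1 - ∑ x : T, t.1 x)
  nonneg := add_nonneg (Finset.sum_nonneg fun x _ => Finsupp.single_nonneg.2 (t.2.1 x))
    (Finsupp.single_nonneg.2 (sub_nonneg.2 t.2.2))
  total := by
    classical
    rw [Finsupp.sum_add_index' (by simp) (by simp),
      ← Finsupp.sum_finsetSum_index (by simp) (by simp)]
    simp only [Finsupp.sum_single_index]
    ring

lemma measurable_ofCoords (x₀ : X) (T : Finset X) : Measurable (ofCoords x₀ T) := by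
  refine measurable_comap_iff.2 (measurable_pi_iff.2 fun y => ?_)
  have h : ∀ x : T, Measurable fun t : coordSimplex T => t.1 x := fun x =>
    (measurable_pi_apply x).comp measurable_subtype_coe
  classical
  simp only [Function.comp_def, ofCoords, Finsupp.add_apply, Finsupp.finsetSum_apply,
    Finsupp.single_apply]
  refine Measurable.add (Finset.measurable_sum _ fun x _ => ?_) ?_
  · split_ifs
    · exact h x
    · exact measurable_const
  · split_ifs
    · exact measurable_const.sub (Finset.measurable_sum _ fun x _ => h x)
    · exact measurable_const

open scoped Classical in
/-- The Lebesgue measure `dω` on the distributions with support in `S`, in the coordinates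
`ω(x)` for `x ∈ S`, `x ≠ x₀`; it does not depend on the choice of `x₀ ∈ S`. -/
def simplexLebesgue (S : Finset X) (x₀ : X) : Measure (StdSimplex ℝ X) :=
  ((volume : Measure (S.erase x₀ → ℝ)).comap Subtype.val).map (ofCoords x₀ (S.erase x₀))

/-- The density of the Dirichlet distribution `Dir(υ)`, on distributions with support in
`supp(υ)`. The exponents `υ x - 1` are genuine since `υ x ≥ 1` for `x ∈ supp(υ)`. -/
def dirichletDensity (υ : X →₀ ℕ) (ω : StdSimplex ℝ X) : ℝ :=
  Real.Gamma (size υ : ℝ) / (∏ x ∈ υ.support, Real.Gamma (υ x : ℝ))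
    * ∏ x ∈ υ.support, ω.weights x ^ (υ x - 1)

/-- The Dirichlet distribution `Dir(υ)`, as a measure on distributions over `X`. -/
def dirichlet (υ : X →₀ ℕ) (x₀ : X) : Measure (StdSimplex ℝ X) :=
  (simplexLebesgue υ.support x₀).withDensity fun ω => ENNReal.ofReal (dirichletDensity υ ω)

end

end Urn

/-! Fix x₀ ∈ S and let T = S \ {x₀}. In the coordinates ℝ^T, attach to each draw φ of size N the
half-open cube of side 1/N at φ/N. A Pólya expectation of h ∘ Flrn is then the integral of a step
function, `polyaStep`, with value N^|T| · pl(φ) · h(Flrn φ) on the cube of φ. As `Nat.multichoose d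
m` is a polynomial in m with leading term m^(d-1)/(d-1)!, the factor N^|T| · pl(φ) is uniformly
bounded and tends to the Dirichlet density at ω when φ/N → ω (`exists_scaled_polyaWeight_le`,
`tendsto_scaled_polyaWeight`). Dominated convergence gives `integrable_and_tendsto_polya`, for every
h that is `FaceContinuous` and bounded on distributions supported in S.

The Kantorovich distance qualifies because of `exists_coupling_le`: if ω' dominates (1-ε)ω, a
coupling of ω can be reused for ω' up to an extra cost ε · diam S. Its measurability is not proved
separately; the product with the density inherits it as an a.e. limit of step functions. The case h
= 1 shows that the Dirichlet measure has total mass one. -/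

namespace Urn

/-! ### Couplings and their perturbation -/

section Coupling

variable {X : Type*}

/-- The product `(x, y) ↦ g x * r y` of two finitely supported functions. -/
noncomputable def tensor (g r : X →₀ ℝ) : X × X →₀ ℝ :=
  g.sum fun x a => r.sum fun y b => Finsupp.single (x, y) (a * b)

lemma tensor_nonneg {g r : X →₀ ℝ} (hg : 0 ≤ g) (hr : 0 ≤ r) : 0 ≤ tensor g r :=
  Finset.sum_nonneg fun x _ => Finset.sum_nonneg fun y _ =>
    Finsupp.single_nonneg.2 (mul_nonneg (hg x) (hr y))

lemma tensor_sum (g r : X →₀ ℝ) (c : X × X → ℝ) :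
    ((tensor g r).sum fun z a => a * c z) =
      g.sum fun x a => r.sum fun y b => a * b * c (x, y) := by
  have h0 : ∀ z : X × X, (0 : ℝ) * c z = 0 := fun z => zero_mul _
  have hadd : ∀ (z : X × X) (a b : ℝ), (a + b) * c z = a * c z + b * c z :=
    fun z a b => add_mul _ _ _
  rw [tensor, Finsupp.sum_sum_index h0 hadd]
  refine Finsupp.sum_congr fun x _ => ?_
  rw [Finsupp.sum_sum_index h0 hadd]
  refine Finsupp.sum_congr fun y _ => ?_
  rw [Finsupp.sum_single_index (h0 _)]

lemma mapDomain_fst_tensor (g r : X →₀ ℝ) :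
    (tensor g r).mapDomain Prod.fst = (r.sum fun _ b => b) • g := by
  conv_rhs => rw [← Finsupp.sum_single g]
  simp only [tensor, Finsupp.sum, Finsupp.mapDomain_finsetSum, Finsupp.mapDomain_single,
    Finset.smul_sum, Finsupp.smul_single, smul_eq_mul]
  refine Finset.sum_congr rfl fun x _ => ?_
  rw [mul_comm, Finset.mul_sum, Finsupp.single_finsetSum]

lemma mapDomain_snd_tensor (g r : X →₀ ℝ) :
    (tensor g r).mapDomain Prod.snd = (g.sum fun _ a => a) • r := by
  conv_rhs => rw [← Finsupp.sum_single r]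
  simp only [tensor, Finsupp.sum, Finsupp.mapDomain_finsetSum, Finsupp.mapDomain_single,
    Finset.smul_sum, Finsupp.smul_single, smul_eq_mul]
  rw [Finset.sum_comm]
  refine Finset.sum_congr rfl fun x _ => ?_
  rw [Finset.sum_mul, Finsupp.single_finsetSum]

lemma sum_add_real (g r : X →₀ ℝ) (c : X → ℝ) :
    ((g + r).sum fun x a => a * c x) = (g.sum fun x a => a * c x) + r.sum fun x a => a * c x :=
  Finsupp.sum_add_index' (fun _ => zero_mul _) (fun _ _ _ => add_mul _ _ _)

lemma sum_smul_real (s : ℝ) (g : X →₀ ℝ) (c : X → ℝ) :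
    ((s • g).sum fun x a => a * c x) = s * g.sum fun x a => a * c x := by
  rw [Finsupp.sum_smul_index (fun _ => zero_mul _), Finsupp.mul_sum]
  exact Finsupp.sum_congr fun x _ => mul_assoc _ _ _

lemma sum_sub_smul (ω ω' : StdSimplex ℝ X) (s : ℝ) :
    ((ω'.weights - s • ω.weights).sum fun _ a => a) = 1 - s := by
  have h := sum_add_real ω'.weights ((-s) • ω.weights) fun _ => 1
  rw [sum_smul_real] at h
  simp only [mul_one, StdSimplex.total] at h
  rw [sub_eq_add_neg, ← neg_smul, h]
  ring

/-- Keep the fraction 1-ε of τ and send the leftover mass g = ω' - (1-ε)ω, of total ε, to ρ by the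
product `tensor g ρ`. Its marginals are g and ερ, so the sum couples ω' with ρ, and the product part
costs at most εD. Leaving g unnormalised avoids a separate case ε = 0. -/
lemma exists_coupling_le {ω ω' ρ : StdSimplex ℝ X} (τ : Coupling ω ρ) {c : X × X → ℝ}
    {S : Finset X} (hω : ω.weights.support ⊆ S) (hω' : ω'.weights.support ⊆ S)
    (hρ : ρ.weights.support ⊆ S) {D : ℝ} (hD : ∀ x ∈ S, ∀ y ∈ S, c (x, y) ≤ D)
    {ε : ℝ} (hε : ε ≤ 1) (hle : ∀ x, (1 - ε) * ω.weights x ≤ ω'.weights x) :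
    ∃ τ' : Coupling ω' ρ, validity τ'.1 c ≤ (1 - ε) * validity τ.1 c + ε * D := by
  set g : X →₀ ℝ := ω'.weights - (1 - ε) • ω.weights with hgdef
  have hg : 0 ≤ g := fun x => by simpa [hgdef] using hle x
  have hgsum : (g.sum fun _ a => a) = ε := by rw [hgdef, sum_sub_smul]; ring
  set P : X × X →₀ ℝ := (1 - ε) • τ.1.weights + tensor g ρ.weights with hP
  have hP0 : 0 ≤ P := add_nonneg
    (fun z => mul_nonneg (by linarith) (τ.1.nonneg z)) (tensor_nonneg hg ρ.nonneg)
  have hfst : P.mapDomain Prod.fst = ω'.weights := by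
    have h := congrArg StdSimplex.weights τ.2.1
    rw [StdSimplex.weights_map] at h
    rw [hP, Finsupp.mapDomain_add, Finsupp.mapDomain_smul, h, mapDomain_fst_tensor,
      StdSimplex.total, one_smul, hgdef]
    abel
  have hsnd : P.mapDomain Prod.snd = ρ.weights := by
    have h := congrArg StdSimplex.weights τ.2.2
    rw [StdSimplex.weights_map] at h
    rw [hP, Finsupp.mapDomain_add, Finsupp.mapDomain_smul, h, mapDomain_snd_tensor, hgsum,
      ← add_smul]
    simp
  have htot : (P.sum fun _ r => r) = 1 := by
    rw [← ρ.total, ← hsnd, Finsupp.sum_mapDomain_index (by simp) (by simp)]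
  refine ⟨⟨⟨P, hP0, htot⟩, StdSimplex.ext hfst, StdSimplex.ext hsnd⟩, ?_⟩
  have hgS : g.support ⊆ S := fun x hx => by
    by_contra hxS
    have h1 : ω.weights x = 0 := by
      by_contra h; exact hxS (hω (Finsupp.mem_support_iff.2 h))
    have h2 : ω'.weights x = 0 := by
      by_contra h; exact hxS (hω' (Finsupp.mem_support_iff.2 h))
    exact (Finsupp.mem_support_iff.1 hx) (by simp [hgdef, h1, h2])
  have hcost : (P.sum fun z a => a * c z) =
      (1 - ε) * validity τ.1 c + g.sum fun x a => ρ.weights.sum fun y b => a * b * c (x, y) := by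
    rw [hP, sum_add_real, sum_smul_real, tensor_sum]; rfl
  have hbound : (g.sum fun x a => ρ.weights.sum fun y b => a * b * c (x, y)) ≤ ε * D := by
    have h1 : ε * D = g.sum fun x a => ρ.weights.sum fun y b => a * b * D := by
      rw [← hgsum, Finsupp.sum_mul]
      refine Finsupp.sum_congr fun x _ => ?_
      rw [← Finsupp.sum_mul, ← Finsupp.mul_sum, StdSimplex.total, mul_one]
    rw [h1]
    exact Finset.sum_le_sum fun x hx => Finset.sum_le_sum fun y hy =>
      mul_le_mul_of_nonneg_left (hD x (hgS hx) y (hρ hy)) (mul_nonneg (hg x) (ρ.nonneg y))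
  simp only [validity] at hcost ⊢
  linarith

/-- The diagonal coupling. -/
noncomputable def diagCoupling (ρ : StdSimplex ℝ X) : Coupling ρ ρ :=
  ⟨ρ.map fun x => (x, x), by rw [StdSimplex.map_map]; exact StdSimplex.map_id ρ,
    by rw [StdSimplex.map_map]; exact StdSimplex.map_id ρ⟩

end Coupling

/-! ### Bounds and continuity for the Kantorovich distance -/

section Kantorovich

variable {X : Type*} [MetricSpace X]

lemma validity_nonneg {Y : Type*} (ω : StdSimplex ℝ Y) {p : Y → ℝ} (hp : ∀ x, 0 ≤ p x) :
    0 ≤ validity ω p :=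
  Finset.sum_nonneg fun x _ => mul_nonneg (ω.nonneg x) (hp x)

lemma kantorovich_nonneg (ω ω' : StdSimplex ℝ X) : 0 ≤ kantorovich ω ω' :=
  Real.iInf_nonneg fun τ => validity_nonneg τ.1 fun _ => dist_nonneg

lemma kantorovich_le_validity {ω ω' : StdSimplex ℝ X} (τ : Coupling ω ω') :
    kantorovich ω ω' ≤ validity τ.1 fun z => dist z.1 z.2 :=
  ciInf_le ⟨0, by rintro _ ⟨τ, rfl⟩; exact validity_nonneg τ.1 fun _ => dist_nonneg⟩ τ

variable {S : Finset X} {ω ω' ρ : StdSimplex ℝ X} {D : ℝ}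

lemma exists_coupling_le_of_support_subset (hω : ω.weights.support ⊆ S)
    (hρ : ρ.weights.support ⊆ S) (hD : ∀ x ∈ S, ∀ y ∈ S, dist x y ≤ D) :
    ∃ τ : Coupling ω ρ, (validity τ.1 fun z => dist z.1 z.2) ≤ D := by
  -- Here ε = 1: nothing of the diagonal coupling survives, and the result is the product coupling.
  obtain ⟨τ, hτ⟩ := exists_coupling_le (diagCoupling ρ) (c := fun z => dist z.1 z.2)
    hρ hω hρ hD le_rfl (fun x => by simp)
  exact ⟨τ, by simpa using hτ⟩

lemma kantorovich_le (hω : ω.weights.support ⊆ S) (hρ : ρ.weights.support ⊆ S)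
    (hD : ∀ x ∈ S, ∀ y ∈ S, dist x y ≤ D) : kantorovich ω ρ ≤ D :=
  let ⟨τ, hτ⟩ := exists_coupling_le_of_support_subset hω hρ hD
  (kantorovich_le_validity τ).trans hτ

lemma kantorovich_le_add (hω : ω.weights.support ⊆ S) (hω' : ω'.weights.support ⊆ S)
    (hρ : ρ.weights.support ⊆ S) (hD : ∀ x ∈ S, ∀ y ∈ S, dist x y ≤ D)
    {ε : ℝ} (hε0 : 0 ≤ ε) (hε : ε ≤ 1) (hle : ∀ x, (1 - ε) * ω.weights x ≤ ω'.weights x) :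
    kantorovich ω' ρ ≤ kantorovich ω ρ + ε * D := by
  obtain ⟨τ₀, _⟩ := exists_coupling_le_of_support_subset hω hρ hD
  have : Nonempty (Coupling ω ρ) := ⟨τ₀⟩
  rw [← sub_le_iff_le_add]
  refine le_ciInf fun τ => ?_
  obtain ⟨τ', hτ'⟩ := exists_coupling_le τ (c := fun z => dist z.1 z.2) hω hω' hρ hD hε hle
  have h1 := kantorovich_le_validity τ'
  have h2 : 0 ≤ validity τ.1 fun z => dist z.1 z.2 := validity_nonneg τ.1 fun _ => dist_nonneg
  nlinarith

/-- The Kantorovich distance to `ρ` is continuous along sequences that converge pointwise from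
within the face of the limit. -/
lemma tendsto_kantorovich {ωs : ℕ → StdSimplex ℝ X} (hω : ω.weights.support ⊆ S)
    (hωs : ∀ n, (ωs n).weights.support ⊆ ω.weights.support) (hρ : ρ.weights.support ⊆ S)
    (hlim : ∀ x, Tendsto (fun n => (ωs n).weights x) atTop (𝓝 (ω.weights x))) :
    Tendsto (fun n => kantorovich (ωs n) ρ) atTop (𝓝 (kantorovich ω ρ)) := by
  set D : ℝ := Metric.diam (S : Set X)
  have hD : ∀ x ∈ S, ∀ y ∈ S, dist x y ≤ D := fun x hx y hy =>
    Metric.dist_le_diam_of_mem S.finite_toSet.isBounded hx hy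
  have hD0 : 0 ≤ D := Metric.diam_nonneg
  rw [Metric.tendsto_nhds]
  intro δ hδ
  obtain ⟨ε, hε0, hε1, hεD⟩ : ∃ ε : ℝ, 0 < ε ∧ ε ≤ 1 ∧ ε * D < δ := by
    -- The denominator D + 1 covers D = 0, when all of S is a single point.
    refine ⟨min 1 (δ / (D + 1)), by positivity, min_le_left _ _, ?_⟩
    calc min 1 (δ / (D + 1)) * D ≤ δ / (D + 1) * D :=
          mul_le_mul_of_nonneg_right (min_le_right _ _) hD0
      _ < δ := by rw [div_mul_eq_mul_div, div_lt_iff₀ (by positivity)]; nlinarith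
  -- Continuity needs the comparison in both directions; on the finite support of ω, where the
  -- limits are positive, both hold eventually.
  have hev : ∀ x ∈ ω.weights.support, ∀ᶠ n in atTop,
      (1 - ε) * ω.weights x ≤ (ωs n).weights x ∧ (1 - ε) * (ωs n).weights x ≤ ω.weights x := by
    intro x hx
    have hpos : 0 < ω.weights x :=
      lt_of_le_of_ne (ω.nonneg x) (Finsupp.mem_support_iff.1 hx).symm
    have hlt : (1 - ε) * ω.weights x < ω.weights x := by nlinarith
    exact (Filter.Tendsto.eventually_const_le hlt (hlim x)).and
      (Filter.Tendsto.eventually_le_const hlt ((hlim x).const_mul (1 - ε)))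
  filter_upwards [(Filter.eventually_all_finset _).2 hev] with n hn
  -- Staying in the face of ω matters here: a stray weight of `ωs n` where ω vanishes would break
  -- the second comparison for ε < 1.
  have hzero : ∀ x, x ∉ ω.weights.support → ω.weights x = 0 ∧ (ωs n).weights x = 0 := fun x hx =>
    ⟨Finsupp.notMem_support_iff.1 hx, Finsupp.notMem_support_iff.1 fun h => hx (hωs n h)⟩
  have hn1 : ∀ x, (1 - ε) * ω.weights x ≤ (ωs n).weights x := fun x => by
    by_cases hx : x ∈ ω.weights.support
    · exact (hn x hx).1
    · simp [hzero x hx]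
  have hn2 : ∀ x, (1 - ε) * (ωs n).weights x ≤ ω.weights x := fun x => by
    by_cases hx : x ∈ ω.weights.support
    · exact (hn x hx).2
    · simp [hzero x hx]
  have h1 := kantorovich_le_add hω ((hωs n).trans hω) hρ hD hε0.le hε1 hn1
  have h2 := kantorovich_le_add ((hωs n).trans hω) hω hρ hD hε0.le hε1 hn2
  rw [Real.dist_eq, abs_lt]
  constructor <;> linarith

end Kantorovich

/-! ### Asymptotics of multichoose coefficients -/

section Multichoose

open Nat in
-- The product (m+1)⋯(m+d-1) has d-1 factors, each between m and m+d; this yields the two-sided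
-- bounds below.
lemma multichoose_mul_factorial {d : ℕ} (hd : 0 < d) (m : ℕ) :
    Nat.multichoose d m * (d - 1)! = (m + 1).ascFactorial (d - 1) := by
  rw [Nat.ascFactorial_eq_factorial_mul_choose, mul_comm, Nat.multichoose_eq,
    show d + m - 1 = m + (d - 1) by omega, Nat.choose_symm_add]

open Nat in
lemma pow_le_multichoose_div {d : ℕ} (hd : 0 < d) (m : ℕ) {N : ℝ} (hN : 0 < N) :
    (m / N) ^ (d - 1) / (d - 1)! ≤ (Nat.multichoose d m : ℝ) / N ^ (d - 1) := by
  have hf : (0 : ℝ) < (d - 1)! := by positivity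
  rw [div_pow, div_div, mul_comm, ← div_div, div_le_div_iff_of_pos_right (by positivity),
    div_le_iff₀ hf]
  have h := (Nat.pow_le_pow_left m.le_succ (d - 1)).trans (Nat.pow_succ_le_ascFactorial _ _)
  rw [← multichoose_mul_factorial hd] at h
  exact_mod_cast h

open Nat in
lemma multichoose_div_le_pow {d : ℕ} (hd : 0 < d) (m : ℕ) {N : ℝ} (hN : 0 < N) :
    (Nat.multichoose d m : ℝ) / N ^ (d - 1) ≤ ((m + d) / N) ^ (d - 1) / (d - 1)! := by
  have hf : (0 : ℝ) < (d - 1)! := by positivity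
  rw [div_pow, div_div, mul_comm (N ^ _), ← div_div, div_le_div_iff_of_pos_right (by positivity),
    le_div_iff₀ hf]
  have h := (Nat.ascFactorial_le_pow_add m (d - 1)).trans
    (Nat.pow_le_pow_left (Nat.add_le_add_left (Nat.sub_le d 1) m) (d - 1))
  rw [← multichoose_mul_factorial hd] at h
  exact_mod_cast h

open Nat in
lemma tendsto_multichoose_div {d : ℕ} (hd : 0 < d) {m : ℕ → ℕ} {s : ℝ}
    (hm : Tendsto (fun K : ℕ => (m K : ℝ) / ((K + 1 : ℕ) : ℝ)) atTop (𝓝 s)) :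
    Tendsto (fun K : ℕ => (Nat.multichoose d (m K) : ℝ) / ((K + 1 : ℕ) : ℝ) ^ (d - 1)) atTop
      (𝓝 (s ^ (d - 1) / (d - 1)!)) := by
  have hN : ∀ K : ℕ, (0 : ℝ) < ((K + 1 : ℕ) : ℝ) := fun K => by positivity
  have hd0 : Tendsto (fun K : ℕ => (d : ℝ) / ((K + 1 : ℕ) : ℝ)) atTop (𝓝 0) :=
    (tendsto_const_div_atTop_nhds_zero_nat (d : ℝ)).comp (tendsto_add_atTop_nat 1)
  refine tendsto_of_tendsto_of_tendsto_of_le_of_le ((hm.pow _).div_const _)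
    (h := fun K : ℕ => ((m K + d) / ((K + 1 : ℕ) : ℝ)) ^ (d - 1) / (d - 1)!) ?_
    (fun K => pow_le_multichoose_div hd (m K) (hN K))
    (fun K => multichoose_div_le_pow hd (m K) (hN K))
  have h := ((hm.add hd0).pow (d - 1)).div_const ((d - 1)! : ℝ)
  simpa only [add_zero, ← add_div] using h

open Nat in
lemma multichoose_div_le {d : ℕ} (hd : 0 < d) {m N : ℕ} (hN : 0 < N) (hm : m ≤ N) :
    (Nat.multichoose d m : ℝ) / (N : ℝ) ^ (d - 1) ≤ (1 + d) ^ (d - 1) := by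
  have hN' : (1 : ℝ) ≤ N := by exact_mod_cast hN
  have hm' : (m : ℝ) ≤ N := by exact_mod_cast hm
  refine (multichoose_div_le_pow hd m (by linarith)).trans ?_
  refine (_root_.div_le_self (by positivity) (by exact_mod_cast (d - 1).factorial_pos)).trans ?_
  refine pow_le_pow_left₀ (by positivity) ?_ _
  rw [div_le_iff₀ (by linarith)]
  nlinarith [(Nat.cast_nonneg d : (0 : ℝ) ≤ d)]

end Multichoose

/-! ### Rescaled Pólya weights -/

section Polya

variable {X : Type*}

lemma pos_of_mem_support {υ : X →₀ ℕ} {x : X} (hx : x ∈ υ.support) : 0 < υ x :=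
  Nat.pos_of_ne_zero (Finsupp.mem_support_iff.1 hx)

lemma le_of_size_eq {φ : X →₀ ℕ} {K : ℕ} (h : size φ = K) (x : X) : φ x ≤ K := by
  by_cases hx : x ∈ φ.support
  · rw [← h]
    exact Finset.single_le_sum (f := fun x => φ x) (fun _ _ => Nat.zero_le _) hx
  · simp [Finsupp.notMem_support_iff.1 hx]

lemma sum_pred_add_card (υ : X →₀ ℕ) :
    ∑ x ∈ υ.support, (υ x - 1) + υ.support.card = size υ := by
  rw [Finset.card_eq_sum_ones, ← Finset.sum_add_distrib]
  exact Finset.sum_congr rfl fun x hx => Nat.sub_add_cancel (pos_of_mem_support hx)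

/-- The exponents match because L - 1 = (|S| - 1) + ∑ (υ x - 1), so each multichoose coefficient
receives exactly the power of N that normalises it. -/
lemma scaled_polyaWeight {υ : X →₀ ℕ} (hυ : υ ≠ 0) {N : ℕ} (hN : 0 < N) (φ : Multi N X) :
    (N : ℝ) ^ (υ.support.card - 1) * polyaWeight υ N φ =
      (∏ x ∈ υ.support, (Nat.multichoose (υ x) (φ.1 x) : ℝ) / (N : ℝ) ^ (υ x - 1)) /
        ((Nat.multichoose (size υ) N : ℝ) / (N : ℝ) ^ (size υ - 1)) := by
  have hN' : (N : ℝ) ≠ 0 := by exact_mod_cast hN.ne'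
  have hm : (Nat.multichoose (size υ) N : ℝ) ≠ 0 := by
    exact_mod_cast (multichoose_pos (size_pos hυ) N).ne'
  have hcard : 0 < υ.support.card := Finset.card_pos.2 (Finsupp.support_nonempty_iff.2 hυ)
  have hexp : size υ - 1 = υ.support.card - 1 + ∑ x ∈ υ.support, (υ x - 1) := by
    have := sum_pred_add_card υ
    omega
  rw [polyaWeight, Finset.prod_div_distrib, Finset.prod_pow_eq_pow_sum, hexp, pow_add]
  field_simp

lemma polyaWeight_nonneg (υ : X →₀ ℕ) (K : ℕ) (φ : Multi K X) : 0 ≤ polyaWeight υ K φ :=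
  div_nonneg (Finset.prod_nonneg fun _ _ => Nat.cast_nonneg _) (Nat.cast_nonneg _)

lemma exists_scaled_polyaWeight_le {υ : X →₀ ℕ} (hυ : υ ≠ 0) :
    ∃ C : ℝ, 0 ≤ C ∧ ∀ {N : ℕ}, 0 < N → ∀ φ : Multi N X,
      (N : ℝ) ^ (υ.support.card - 1) * polyaWeight υ N φ ≤ C := by
  refine ⟨(∏ x ∈ υ.support, (1 + (υ x : ℝ)) ^ (υ x - 1)) /
    (1 / ((size υ - 1).factorial : ℝ)), by positivity, fun {N} hN φ => ?_⟩
  have hN' : (0 : ℝ) < N := by exact_mod_cast hN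
  rw [scaled_polyaWeight hυ hN]
  refine div_le_div₀ (by positivity) (Finset.prod_le_prod (fun _ _ => by positivity) fun x hx =>
    multichoose_div_le (pos_of_mem_support hx) hN (le_of_size_eq φ.2 x)) (by positivity) ?_
  -- With m = N the lower bound is (N/N)^(L-1)/(L-1)!, so the denominator stays away from 0.
  simpa [div_self hN'.ne'] using pow_le_multichoose_div (size_pos hυ) N hN'

/-- Each factor converges to ω(x)^(υ(x)-1)/(υ(x)-1)! and the denominator to 1/(L-1)!; these
factorials are the Gamma values in the normalising constant. -/
lemma tendsto_scaled_polyaWeight {υ : X →₀ ℕ} (hυ : υ ≠ 0) {φ : ∀ K : ℕ, Multi (K + 1) X}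
    {ω : StdSimplex ℝ X}
    (hφ : ∀ x, Tendsto (fun K => (flrn (φ K).1 (φ K).ne_zero).weights x) atTop
      (𝓝 (ω.weights x))) :
    Tendsto (fun K : ℕ => ((K + 1 : ℕ) : ℝ) ^ (υ.support.card - 1) *
      polyaWeight υ (K + 1) (φ K)) atTop (𝓝 (dirichletDensity υ ω)) := by
  simp only [scaled_polyaWeight hυ (Nat.succ_pos _)]
  have hL := size_pos hυ
  have hden : Tendsto (fun K : ℕ => (Nat.multichoose (size υ) (K + 1) : ℝ) /
      ((K + 1 : ℕ) : ℝ) ^ (size υ - 1)) atTop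
      (𝓝 (1 ^ (size υ - 1) / ((size υ - 1).factorial : ℝ))) := by
    refine tendsto_multichoose_div hL (tendsto_const_nhds.congr fun K => ?_)
    rw [div_self (by positivity)]
  have hnum := tendsto_finsetProd υ.support fun x hx =>
    tendsto_multichoose_div (pos_of_mem_support hx) (m := fun K => (φ K).1 x)
      (s := ω.weights x) ((hφ x).congr fun K => by simp [flrn, (φ K).2])
  have hG : ∀ {d : ℕ}, 0 < d → Real.Gamma (d : ℝ) = ((d - 1).factorial : ℝ) := fun {d} hd => by
    obtain ⟨e, rfl⟩ := Nat.exists_eq_add_of_lt hd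
    simp [Real.Gamma_nat_eq_factorial]
  have hne : (∏ x ∈ υ.support, ((υ x - 1).factorial : ℝ)) ≠ 0 :=
    Finset.prod_ne_zero_iff.2 fun x _ => by positivity
  have heq : dirichletDensity υ ω = (∏ x ∈ υ.support, ω.weights x ^ (υ x - 1) /
      ((υ x - 1).factorial : ℝ)) / (1 ^ (size υ - 1) / ((size υ - 1).factorial : ℝ)) := by
    rw [dirichletDensity, hG hL, Finset.prod_congr rfl fun x hx => hG (pos_of_mem_support hx),
      Finset.prod_div_distrib]
    field_simp
    simp
  rw [heq]
  exact hnum.div hden (by positivity)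

lemma dirichletDensity_nonneg (υ : X →₀ ℕ) (ω : StdSimplex ℝ X) : 0 ≤ dirichletDensity υ ω := by
  refine mul_nonneg (div_nonneg (Real.Gamma_nonneg_of_nonneg (Nat.cast_nonneg _))
    (Finset.prod_nonneg fun x _ => Real.Gamma_nonneg_of_nonneg (Nat.cast_nonneg _)))
    (Finset.prod_nonneg fun x _ => pow_nonneg (ω.nonneg x) _)

lemma validity_polya (υ : X →₀ ℕ) (hυ : υ ≠ 0) (K : ℕ) (p : Multi K X → ℝ) :
    validity (polya υ hυ K) p = ∑ φ ∈ draws υ K, polyaWeight υ K φ * p φ := by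
  classical
  rw [validity, polya,
    Finsupp.sum_of_support_subset _ (Finsupp.support_indicator_subset _ _) _ (by simp)]
  exact Finset.sum_congr rfl fun φ hφ => by simp [Finsupp.indicator_apply, hφ]

end Polya

/-! ### Measurability and simplex coordinates -/

section Measure

variable {X : Type*}

lemma measurable_weights (x : X) : Measurable fun ω : StdSimplex ℝ X => ω.weights x :=
  (measurable_pi_apply x).comp (comap_measurable _)

lemma measurable_dirichletDensity (υ : X →₀ ℕ) : Measurable (dirichletDensity υ) :=
  (Finset.measurable_prod _ fun x _ => (measurable_weights x).pow_const _).const_mul _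

lemma measurableSet_coordSimplex (T : Finset X) : MeasurableSet (coordSimplex T) := by
  have h : coordSimplex T = (⋂ x, {t | 0 ≤ t x}) ∩ {t | ∑ x, t x ≤ 1} := by
    ext; simp [coordSimplex]
  rw [h]
  exact (MeasurableSet.iInter fun x => measurableSet_le measurable_const
    (measurable_pi_apply x)).inter (measurableSet_le
      (Finset.measurable_sum _ fun x _ => measurable_pi_apply x) measurable_const)

variable {x₀ : X} {T : Finset X}

lemma ofCoords_apply_of_mem (hx₀ : x₀ ∉ T) (t : coordSimplex T) (x : T) :
    (ofCoords x₀ T t).weights x = t.1 x := by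
  classical
  have h : x₀ ≠ x := fun h => hx₀ (h ▸ x.2)
  simp [ofCoords, Finsupp.single_apply, h]

lemma ofCoords_apply_self (hx₀ : x₀ ∉ T) (t : coordSimplex T) :
    (ofCoords x₀ T t).weights x₀ = 1 - ∑ x, t.1 x := by
  classical
  have h : ∀ x : T, (x : X) ≠ x₀ := fun x h => hx₀ (h ▸ x.2)
  simp [ofCoords, h]

lemma ofCoords_apply_of_notMem {y : X} (hy₀ : y ≠ x₀) (hy : y ∉ T) (t : coordSimplex T) :
    (ofCoords x₀ T t).weights y = 0 := by
  classical
  have h : ∀ x : T, (x : X) ≠ y := fun x h => hy (h ▸ x.2)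
  simp [ofCoords, h, hy₀.symm]

lemma sum_weights_le_one (ω : StdSimplex ℝ X) (T : Finset X) : ∑ x ∈ T, ω.weights x ≤ 1 := by
  classical
  rw [← ω.total, Finsupp.sum_of_support_subset (s := T ∪ ω.weights.support) _
    Finset.subset_union_right _ (by simp)]
  exact Finset.sum_le_sum_of_subset_of_nonneg Finset.subset_union_left fun x _ _ => ω.nonneg x

lemma weights_eq_zero_of_sum_eq_one {ω : StdSimplex ℝ X} {T : Finset X}
    (h : ∑ x ∈ T, ω.weights x = 1) {x : X} (hx : x ∉ T) : ω.weights x = 0 := by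
  classical
  have h1 := sum_weights_le_one ω (insert x T)
  rw [Finset.sum_insert hx, h] at h1
  exact le_antisymm (by linarith) (ω.nonneg x)

/-- The coordinates `ω x`, `x ∈ T`, of a distribution. -/
def toCoords (T : Finset X) (ω : StdSimplex ℝ X) : coordSimplex T :=
  ⟨fun x => ω.weights x, fun x => ω.nonneg x, by
    rw [Finset.sum_coe_sort T fun x => ω.weights x]; exact sum_weights_le_one ω T⟩

/-- Integrals can be moved along a measurable embedding with no measurability assumption on the
integrand, which is what an arbitrary h requires. -/
lemma measurableEmbedding_ofCoords (hx₀ : x₀ ∉ T) : MeasurableEmbedding (ofCoords x₀ T) := by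
  classical
  have hto : Measurable (toCoords T) :=
    (measurable_pi_iff.2 fun x : T => measurable_weights (x : X)).subtype_mk
  refine .of_measurable_inverse (measurable_ofCoords x₀ T) ?_ hto fun t =>
    Subtype.ext (funext fun x => ofCoords_apply_of_mem hx₀ t x)
  -- All mass lies on `insert x₀ T` exactly when these finitely many weights sum to 1, and that is a
  -- measurable condition.
  have hrange : Set.range (ofCoords x₀ T) =
      {ω : StdSimplex ℝ X | ∑ x ∈ insert x₀ T, ω.weights x = 1} := by
    ext ω
    simp only [Set.mem_range, Set.mem_ofPred_eq, Finset.sum_insert hx₀]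
    constructor
    · rintro ⟨t, rfl⟩
      rw [ofCoords_apply_self hx₀, ← Finset.sum_coe_sort T]
      simp only [ofCoords_apply_of_mem hx₀]
      ring
    · intro h
      refine ⟨toCoords T ω, StdSimplex.ext (Finsupp.ext fun y => ?_)⟩
      by_cases hy : y ∈ T
      · exact ofCoords_apply_of_mem hx₀ _ ⟨y, hy⟩
      by_cases hy0 : y = x₀
      · subst hy0
        rw [ofCoords_apply_self hx₀, toCoords, Finset.sum_coe_sort T fun x => ω.weights x]
        linarith
      · rw [ofCoords_apply_of_notMem hy0 hy]
        refine (weights_eq_zero_of_sum_eq_one (T := insert x₀ T) ?_ (by simp [hy, hy0])).symm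
        rwa [Finset.sum_insert hx₀]
  rw [hrange]
  exact measurableSet_eq_fun (Finset.measurable_sum _ fun x _ => measurable_weights x)
    measurable_const

end Measure

variable {X : Type*}

lemma size_eq_sum {φ : X →₀ ℕ} {S : Finset X} (h : φ.support ⊆ S) : size φ = ∑ x ∈ S, φ x :=
  Finsupp.sum_of_support_subset _ h _ fun _ _ => rfl

lemma flrn_apply (φ : X →₀ ℕ) (hφ : φ ≠ 0) (x : X) :
    (flrn φ hφ).weights x = (φ x : ℝ) / (size φ : ℝ) :=
  rfl

lemma support_flrn_subset (φ : X →₀ ℕ) (hφ : φ ≠ 0) :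
    (flrn φ hφ).weights.support ⊆ φ.support :=
  Finsupp.support_mapRange (hf := by simp)

/-! ### Cubes around the lattice points of the simplex -/

/-- The half-open cube of side `1 / N` whose least corner is `φ / N`. -/
def cube (T : Finset X) (N : ℕ) (φ : X →₀ ℕ) : Set (T → ℝ) :=
  Set.univ.pi fun x => Set.Ico ((φ x : ℝ) / N) ((φ x + 1 : ℝ) / N)

lemma measurableSet_cube (T : Finset X) (N : ℕ) (φ : X →₀ ℕ) : MeasurableSet (cube T N φ) :=
  .univ_pi fun _ => measurableSet_Ico

lemma volume_real_cube (T : Finset X) {N : ℕ} (hN : 0 < N) (φ : X →₀ ℕ) :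
    volume.real (cube T N φ) = ((N : ℝ) ^ T.card)⁻¹ := by
  have hN' : (0 : ℝ) < N := by exact_mod_cast hN
  rw [cube, Measure.real, Real.volume_pi_Ico_toReal fun x => by gcongr; linarith]
  simp [← sub_div]

lemma volume_cube_ne_top (T : Finset X) (N : ℕ) (φ : X →₀ ℕ) :
    volume (cube T N φ) ≠ ⊤ := by
  rw [cube, Real.volume_pi_Ico]
  exact ENNReal.prod_ne_top fun _ _ => ENNReal.ofReal_ne_top

/-- Cubes are the fibres of the floor map on nonnegative points; nonnegativity is stated separately
because `⌊·⌋₊` sends negative numbers to 0. -/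
lemma mem_cube_iff {T : Finset X} {N : ℕ} (hN : 0 < N) {φ : X →₀ ℕ} {t : T → ℝ} :
    t ∈ cube T N φ ↔ ∀ x : T, 0 ≤ t x ∧ ⌊t x * N⌋₊ = φ x := by
  have hN' : (0 : ℝ) < N := by exact_mod_cast hN
  simp only [cube, Set.mem_univ_pi, Set.mem_Ico, div_le_iff₀ hN', lt_div_iff₀ hN']
  refine forall_congr' fun x => ⟨fun h => ?_, fun h => ?_⟩
  · have h0 : 0 ≤ t x * N := (Nat.cast_nonneg _).trans h.1
    exact ⟨nonneg_of_mul_nonneg_left h0 hN', (Nat.floor_eq_iff h0).2 h⟩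
  · exact (Nat.floor_eq_iff (mul_nonneg h.1 hN'.le)).1 h.2

/-- The floors of t determine the multiplicities on T, and the size N then fixes the one at x₀. -/
lemma eq_of_mem_cube {T : Finset X} {x₀ : X} (hx₀ : x₀ ∉ T) {N : ℕ} (hN : 0 < N)
    {φ ψ : Multi N X} [DecidableEq X] (hφ : φ.1.support ⊆ insert x₀ T)
    (hψ : ψ.1.support ⊆ insert x₀ T) {t : T → ℝ} (htφ : t ∈ cube T N φ.1)
    (htψ : t ∈ cube T N ψ.1) : φ = ψ := by
  have hT : ∀ x ∈ T, φ.1 x = ψ.1 x := fun x hx => by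
    rw [← ((mem_cube_iff hN).1 htφ ⟨x, hx⟩).2, ← ((mem_cube_iff hN).1 htψ ⟨x, hx⟩).2]
  have h0 : φ.1 x₀ = ψ.1 x₀ := by
    have h1 := (size_eq_sum hφ).symm.trans φ.2
    have h2 := (size_eq_sum hψ).symm.trans ψ.2
    rw [Finset.sum_insert hx₀] at h1 h2
    rw [Finset.sum_congr rfl hT] at h1
    exact Nat.add_right_cancel (h1.trans h2.symm)
  refine Subtype.ext (Finsupp.ext fun x => ?_)
  by_cases hx : x ∈ insert x₀ T
  · rcases Finset.mem_insert.1 hx with rfl | hx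
    · exact h0
    · exact hT x hx
  · rw [Finsupp.notMem_support_iff.1 fun h => hx (hφ h),
      Finsupp.notMem_support_iff.1 fun h => hx (hψ h)]

/-- An affine subspace that misses the origin is proper, hence Lebesgue-null. -/
lemma volume_sum_eq_one (T : Finset X) :
    volume {t : T → ℝ | ∑ x, t x = 1} = 0 := by
  let A : AffineSubspace ℝ (T → ℝ) :=
    { carrier := {t | ∑ x, t x = 1}
      smul_vsub_vadd_mem' := fun c p q r hp hq hr => by
        simp only [Set.mem_ofPred_eq] at hp hq hr ⊢
        simp only [vsub_eq_sub, vadd_eq_add, Pi.add_apply, Pi.smul_apply, Pi.sub_apply,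
          smul_eq_mul, Finset.sum_add_distrib, ← Finset.mul_sum, Finset.sum_sub_distrib, hp, hq, hr]
        ring }
  refine Measure.addHaar_affineSubspace volume A fun h => ?_
  have h0 : (0 : T → ℝ) ∈ A := h ▸ AffineSubspace.mem_top ℝ _ _
  have h1 : ∑ x : T, (0 : T → ℝ) x = 1 := h0
  simp at h1

/-! ### Draws near a given distribution -/

/-- This makes the truncated subtraction in `floorDraw` a genuine one. -/
lemma sum_floor_le (T : Finset X) (N : ℕ) (ω : StdSimplex ℝ X) :
    ∑ x ∈ T, ⌊ω.weights x * N⌋₊ ≤ N := by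
  have h : (∑ x ∈ T, (⌊ω.weights x * N⌋₊ : ℝ)) ≤ ∑ x ∈ T, ω.weights x * N :=
    Finset.sum_le_sum fun x _ => Nat.floor_le (mul_nonneg (ω.nonneg x) (Nat.cast_nonneg _))
  rw [← Finset.sum_mul] at h
  have h2 := h.trans (mul_le_mul_of_nonneg_right (sum_weights_le_one ω T) (Nat.cast_nonneg N))
  rw [one_mul] at h2
  exact_mod_cast h2

lemma tendsto_floor_div {a : ℝ} (ha : 0 ≤ a) :
    Tendsto (fun K : ℕ => (⌊a * ((K + 1 : ℕ) : ℝ)⌋₊ : ℝ) / ((K + 1 : ℕ) : ℝ)) atTop (𝓝 a) :=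
  (tendsto_nat_floor_mul_div_atTop ha).comp
    (tendsto_natCast_atTop_atTop.comp (tendsto_add_atTop_nat 1))

section FloorDraw

variable [DecidableEq X] {x₀ : X} {T : Finset X}

/-- The draw of size `N` with multiplicities `⌊N * ω x⌋` for `x ∈ T` and the others at `x₀`. -/
noncomputable def floorDraw (x₀ : X) (T : Finset X) (N : ℕ) (ω : StdSimplex ℝ X) : X →₀ ℕ :=
  Finsupp.onFinset (insert x₀ T)
    (fun x => if x ∈ T then ⌊ω.weights x * N⌋₊
      else if x = x₀ then N - ∑ y ∈ T, ⌊ω.weights y * N⌋₊ else 0)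
    (fun x hx => by
      by_contra h
      rw [Finset.mem_insert, not_or] at h
      exact hx (by rw [if_neg h.2, if_neg h.1]))

lemma support_floorDraw_subset (x₀ : X) (T : Finset X) (N : ℕ) (ω : StdSimplex ℝ X) :
    (floorDraw x₀ T N ω).support ⊆ insert x₀ T :=
  Finsupp.support_onFinset_subset

lemma floorDraw_apply_of_mem {x : X} (hx : x ∈ T) (N : ℕ) (ω : StdSimplex ℝ X) :
    floorDraw x₀ T N ω x = ⌊ω.weights x * N⌋₊ :=
  if_pos hx

lemma floorDraw_apply_self (hx₀ : x₀ ∉ T) (N : ℕ) (ω : StdSimplex ℝ X) :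
    floorDraw x₀ T N ω x₀ = N - ∑ y ∈ T, ⌊ω.weights y * N⌋₊ :=
  (if_neg hx₀).trans (if_pos rfl)

lemma size_floorDraw (hx₀ : x₀ ∉ T) (N : ℕ) (ω : StdSimplex ℝ X) :
    size (floorDraw x₀ T N ω) = N := by
  rw [size_eq_sum (support_floorDraw_subset x₀ T N ω), Finset.sum_insert hx₀,
    floorDraw_apply_self hx₀, Finset.sum_congr rfl fun x hx => floorDraw_apply_of_mem hx N ω]
  exact Nat.sub_add_cancel (sum_floor_le T N ω)

lemma tendsto_floorDraw_div (hx₀ : x₀ ∉ T) {ω : StdSimplex ℝ X}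
    (hω : ω.weights.support ⊆ insert x₀ T) (x : X) :
    Tendsto (fun K : ℕ => (floorDraw x₀ T (K + 1) ω x : ℝ) / ((K + 1 : ℕ) : ℝ)) atTop
      (𝓝 (ω.weights x)) := by
  by_cases hx : x ∈ T
  · simp only [floorDraw_apply_of_mem hx]
    exact tendsto_floor_div (ω.nonneg x)
  by_cases hx0 : x = x₀
  · subst hx0
    have hsum : ω.weights x = 1 - ∑ y ∈ T, ω.weights y := by
      have h := ω.total
      rw [Finsupp.sum_of_support_subset _ hω _ (by simp), Finset.sum_insert hx₀] at h
      linarith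
    rw [hsum]
    refine (tendsto_const_nhds.sub
      (tendsto_finsetSum T fun y _ => tendsto_floor_div (ω.nonneg y))).congr fun K => ?_
    rw [floorDraw_apply_self hx₀, Nat.cast_sub (sum_floor_le T _ ω), sub_div,
      div_self (by positivity), Nat.cast_sum, Finset.sum_div]
  · have hx' : x ∉ insert x₀ T := by simp [hx, hx0]
    rw [Finsupp.notMem_support_iff.1 fun h => hx' (hω h)]
    refine tendsto_const_nhds.congr fun K => ?_
    rw [Finsupp.notMem_support_iff.1 fun h => hx' (support_floorDraw_subset x₀ T _ ω h)]
    simp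

end FloorDraw

/-! ### Step functions -/

/-- The step function on coordinates whose integral is the expected value of `h ∘ Flrn` under the
Pólya distribution of size `K + 1`. -/
noncomputable def polyaStep (υ : X →₀ ℕ) (T : Finset X) (h : StdSimplex ℝ X → ℝ) (K : ℕ)
    (t : T → ℝ) : ℝ :=
  ∑ φ ∈ draws υ (K + 1), (cube T (K + 1) φ.1).indicator
    (fun _ => ((K + 1 : ℕ) : ℝ) ^ T.card * polyaWeight υ (K + 1) φ * h (flrn φ.1 φ.ne_zero)) t

variable {υ : X →₀ ℕ} {T : Finset X} {h : StdSimplex ℝ X → ℝ} {K : ℕ} {t : T → ℝ}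

lemma integrable_indicator_cube (T : Finset X) (N : ℕ) (φ : X →₀ ℕ) (c : ℝ) :
    Integrable ((cube T N φ).indicator fun _ => c) :=
  (integrable_indicator_iff (measurableSet_cube T N φ)).2
    (integrableOn_const (volume_cube_ne_top T N φ))

lemma integrable_polyaStep : Integrable (polyaStep υ T h K) :=
  integrable_finsetSum _ fun φ _ => integrable_indicator_cube T (K + 1) φ.1 _

/-- The cube volume N^(-|T|) cancels the factor N^|T| in the step function. -/
lemma integral_polyaStep (hυ : υ ≠ 0) :
    ∫ t, polyaStep υ T h K t =
      validity (polya υ hυ (K + 1)) fun φ => h (flrn φ.1 φ.ne_zero) := by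
  simp only [polyaStep]
  rw [integral_finsetSum _ fun φ _ => integrable_indicator_cube T (K + 1) φ.1 _, validity_polya]
  refine Finset.sum_congr rfl fun φ _ => ?_
  rw [integral_indicator_const _ (measurableSet_cube T (K + 1) φ.1),
    volume_real_cube T K.succ_pos, smul_eq_mul]
  have : ((K + 1 : ℕ) : ℝ) ^ T.card ≠ 0 := by positivity
  rw [mul_assoc, inv_mul_cancel_left₀ this]

lemma polyaStep_eq_zero (ht : ∀ φ ∈ draws υ (K + 1), t ∉ cube T (K + 1) φ.1) :
    polyaStep υ T h K t = 0 :=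
  Finset.sum_eq_zero fun φ hφ => Set.indicator_of_notMem (ht φ hφ) _

lemma polyaStep_eq [DecidableEq X] {x₀ : X} (hx₀ : x₀ ∉ T) (hυ : υ.support = insert x₀ T)
    {φ : Multi (K + 1) X} (hφ : φ.1.support ⊆ υ.support) (ht : t ∈ cube T (K + 1) φ.1) :
    polyaStep υ T h K t = ((K + 1 : ℕ) : ℝ) ^ (υ.support.card - 1) * polyaWeight υ (K + 1) φ *
      h (flrn φ.1 φ.ne_zero) := by
  rw [polyaStep, Finset.sum_eq_single φ, Set.indicator_of_mem ht, hυ,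
    Finset.card_insert_of_notMem hx₀, Nat.add_sub_cancel]
  · intro ψ hψ hne
    refine Set.indicator_of_notMem (fun h' => hne ?_) _
    exact eq_of_mem_cube hx₀ K.succ_pos (hυ ▸ (mem_draws υ _ ψ).1 hψ) (hυ ▸ hφ) h' ht
  · exact fun h' => absurd ((mem_draws υ _ φ).2 hφ) h'

/-- A function on distributions that is continuous along pointwise convergent sequences, with
supports in `S`, which stay in the face of their limit. -/
def FaceContinuous (S : Finset X) (h : StdSimplex ℝ X → ℝ) : Prop :=
  ∀ (ω : StdSimplex ℝ X) (ωs : ℕ → StdSimplex ℝ X), ω.weights.support ⊆ S →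
    (∀ n, (ωs n).weights.support ⊆ ω.weights.support) →
    (∀ x, Tendsto (fun n => (ωs n).weights x) atTop (𝓝 (ω.weights x))) →
    Tendsto (fun n => h (ωs n)) atTop (𝓝 (h ω))

open scoped Classical in
/-- `h` times the Dirichlet density, in coordinates. -/
noncomputable def coordDirichlet (υ : X →₀ ℕ) (x₀ : X) (T : Finset X) (h : StdSimplex ℝ X → ℝ)
    (t : T → ℝ) : ℝ :=
  if ht : t ∈ coordSimplex T then
    dirichletDensity υ (ofCoords x₀ T ⟨t, ht⟩) * h (ofCoords x₀ T ⟨t, ht⟩) else 0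

/-- Cubes of distinct draws are disjoint, so at most one term is nonzero at t. A cube ends at (φ x +
1)/N ≤ (N + 1)/N ≤ 2, hence the box [0,2]^T serves for every N. -/
lemma exists_polyaStep_le [DecidableEq X] {x₀ : X} (hυ0 : υ ≠ 0) (hx₀ : x₀ ∉ T)
    (hυ : υ.support = insert x₀ T) {C : ℝ}
    (hC : ∀ ω : StdSimplex ℝ X, ω.weights.support ⊆ υ.support → |h ω| ≤ C) :
    ∃ B : (T → ℝ) → ℝ, Integrable B ∧ ∀ K t, |polyaStep υ T h K t| ≤ B t := by
  obtain ⟨A, hA0, hA⟩ := exists_scaled_polyaWeight_le hυ0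
  have hC0 : 0 ≤ C := (abs_nonneg _).trans (hC _ (support_flrn_subset υ hυ0))
  refine ⟨(Set.Icc 0 2 : Set (T → ℝ)).indicator fun _ => A * C,
    (integrable_indicator_iff measurableSet_Icc).2
      (integrableOn_const isCompact_Icc.measure_lt_top.ne), fun K t => ?_⟩
  by_cases hex : ∃ φ ∈ draws υ (K + 1), t ∈ cube T (K + 1) φ.1
  · obtain ⟨φ, hφ, ht⟩ := hex
    have hφ' := (mem_draws υ _ φ).1 hφ
    have hN : (0 : ℝ) < ((K + 1 : ℕ) : ℝ) := by positivity
    have hbox : t ∈ (Set.Icc 0 2 : Set (T → ℝ)) := by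
      refine ⟨fun x => ((mem_cube_iff K.succ_pos).1 ht x).1, fun x => ?_⟩
      have h1 := (ht x (Set.mem_univ _)).2
      have h2 : ((φ.1 x + 1 : ℝ)) / ((K + 1 : ℕ) : ℝ) ≤ 2 := by
        rw [div_le_iff₀ hN]
        have h3 : (φ.1 x : ℝ) ≤ ((K + 1 : ℕ) : ℝ) := by exact_mod_cast le_of_size_eq φ.2 x
        have h4 : (1 : ℝ) ≤ ((K + 1 : ℕ) : ℝ) := by exact_mod_cast K.succ_pos
        linarith
      exact (h1.trans_le h2).le
    rw [polyaStep_eq hx₀ hυ hφ' ht, Set.indicator_of_mem hbox, abs_mul,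
      abs_of_nonneg (mul_nonneg (by positivity) (polyaWeight_nonneg _ _ _))]
    exact mul_le_mul (hA K.succ_pos φ)
      (hC _ ((support_flrn_subset _ _).trans hφ')) (abs_nonneg _) hA0
  · push Not at hex
    rw [polyaStep_eq_zero hex, abs_zero]
    exact Set.indicator_nonneg (fun _ _ => mul_nonneg hA0 hC0) _

/-- The cube around t belongs to the floor draw, whose normalisation tends to ω inside the face of
ω. -/
lemma tendsto_polyaStep_of_mem [DecidableEq X] {x₀ : X} (hυ0 : υ ≠ 0) (hx₀ : x₀ ∉ T)
    (hυ : υ.support = insert x₀ T) (hh : FaceContinuous υ.support h) (ht : t ∈ coordSimplex T)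
    (ht1 : ∑ x, t x ≠ 1) :
    Tendsto (fun K => polyaStep υ T h K t) atTop (𝓝 (coordDirichlet υ x₀ T h t)) := by
  rw [coordDirichlet, dif_pos ht]
  set ω := ofCoords x₀ T ⟨t, ht⟩ with hωdef
  have hωT : ∀ x : T, ω.weights x = t x := ofCoords_apply_of_mem hx₀ ⟨t, ht⟩
  -- Rounding down can leave mass at x₀ even if ω gives it none, which would leave the face; hence
  -- the hyperplane ∑ t = 1 is excluded.
  have hω0 : ω.weights x₀ ≠ 0 := by
    rw [hωdef, ofCoords_apply_self hx₀]
    exact sub_ne_zero.2 ht1.symm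
  have hω : ω.weights.support ⊆ insert x₀ T := fun x hx => by
    by_contra hx'
    rw [Finset.mem_insert, not_or] at hx'
    exact Finsupp.mem_support_iff.1 hx (ofCoords_apply_of_notMem hx'.1 hx'.2 _)
  let φ : ∀ K : ℕ, Multi (K + 1) X := fun K =>
    ⟨floorDraw x₀ T (K + 1) ω, size_floorDraw hx₀ (K + 1) ω⟩
  have hφ : ∀ x, Tendsto (fun K => (flrn (φ K).1 (φ K).ne_zero).weights x) atTop
      (𝓝 (ω.weights x)) := fun x => by
    refine (tendsto_floorDraw_div hx₀ hω x).congr fun K => ?_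
    rw [flrn_apply, (φ K).2]
  have hφsupp : ∀ K, (flrn (φ K).1 (φ K).ne_zero).weights.support ⊆ ω.weights.support := by
    refine fun K => (support_flrn_subset _ _).trans fun x hx => ?_
    rcases Finset.mem_insert.1 (support_floorDraw_subset x₀ T (K + 1) ω hx) with rfl | hxT
    · exact Finsupp.mem_support_iff.2 hω0
    · refine Finsupp.mem_support_iff.2 fun h0 => Finsupp.mem_support_iff.1 hx ?_
      exact (floorDraw_apply_of_mem hxT _ _).trans (by simp [h0])
  have hcube : ∀ K, t ∈ cube T (K + 1) (φ K).1 := fun K =>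
    (mem_cube_iff K.succ_pos).2 fun x =>
      ⟨ht.1 x, by rw [← hωT x]; exact (floorDraw_apply_of_mem x.2 _ _).symm⟩
  have hlim := (tendsto_scaled_polyaWeight hυ0 hφ).mul (hh ω _ (hυ ▸ hω) hφsupp hφ)
  exact hlim.congr fun K => (polyaStep_eq hx₀ hυ
    (hυ ▸ support_floorDraw_subset x₀ T (K + 1) ω) (hcube K)).symm

/-- A point with a negative coordinate lies in no cube. If ∑ t > 1, the floors eventually add up to
more than N, which no draw of size N allows. -/
lemma tendsto_polyaStep_of_notMem (hυ : T ⊆ υ.support) (x₀ : X) (ht : t ∉ coordSimplex T) :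
    Tendsto (fun K => polyaStep υ T h K t) atTop (𝓝 (coordDirichlet υ x₀ T h t)) := by
  rw [coordDirichlet, dif_neg ht]
  by_cases h0 : ∀ x, 0 ≤ t x
  · have h1 : 1 < ∑ x, t x := by
      by_contra h1
      exact ht ⟨h0, not_lt.1 h1⟩
    have hlim := tendsto_finsetSum (Finset.univ : Finset T) fun x _ => tendsto_floor_div (h0 x)
    refine tendsto_const_nhds.congr' ?_
    filter_upwards [Filter.Tendsto.eventually_const_lt h1 hlim] with K hK
    refine (polyaStep_eq_zero fun φ hφ htφ => hK.not_ge ?_).symm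
    have hN : (0 : ℝ) < ((K + 1 : ℕ) : ℝ) := by positivity
    rw [← Finset.sum_div, div_le_one hN, Finset.sum_congr rfl fun x _ => by
      rw [((mem_cube_iff K.succ_pos).1 htφ x).2], Finset.sum_coe_sort T fun x => (φ.1 x : ℝ)]
    have hle := Finset.sum_le_sum_of_subset (f := φ.1) hυ
    rw [← size_eq_sum ((mem_draws υ _ φ).1 hφ), φ.2] at hle
    exact_mod_cast hle
  · push Not at h0
    obtain ⟨x, hx⟩ := h0
    refine tendsto_const_nhds.congr fun K => (polyaStep_eq_zero fun φ _ htφ => ?_).symm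
    exact hx.not_ge ((mem_cube_iff K.succ_pos).1 htφ x).1

/-! ### Dominated convergence and transfer from coordinates -/

lemma coordDirichlet_comp_val (υ : X →₀ ℕ) (x₀ : X) (T : Finset X) (h : StdSimplex ℝ X → ℝ) :
    coordDirichlet υ x₀ T h ∘ Subtype.val =
      (fun ω => dirichletDensity υ ω * h ω) ∘ ofCoords x₀ T :=
  funext fun t => dif_pos t.2

open scoped Classical in
lemma integrable_simplexLebesgue_iff (S : Finset X) (x₀ : X) (υ : X →₀ ℕ)
    (h : StdSimplex ℝ X → ℝ) :
    Integrable (fun ω => dirichletDensity υ ω * h ω) (simplexLebesgue S x₀) ↔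
      Integrable (coordDirichlet υ x₀ (S.erase x₀) h) := by
  rw [simplexLebesgue,
    (measurableEmbedding_ofCoords (Finset.notMem_erase x₀ S)).integrable_map_iff,
    ← coordDirichlet_comp_val, ← integrableOn_iff_comap_subtypeVal (measurableSet_coordSimplex _),
    integrableOn_iff_integrable_of_support_subset]
  intro t ht
  by_contra h'
  exact ht (dif_neg h')

open scoped Classical in
lemma integral_simplexLebesgue (S : Finset X) (x₀ : X) (υ : X →₀ ℕ) (h : StdSimplex ℝ X → ℝ) :
    ∫ ω, dirichletDensity υ ω * h ω ∂(simplexLebesgue S x₀) =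
      ∫ t, coordDirichlet υ x₀ (S.erase x₀) h t := by
  rw [simplexLebesgue,
    (measurableEmbedding_ofCoords (Finset.notMem_erase x₀ S)).integral_map,
    ← setIntegral_eq_integral_of_forall_compl_eq_zero (s := coordSimplex (S.erase x₀))
      (f := coordDirichlet υ x₀ (S.erase x₀) h) (fun t ht => dif_neg ht),
    ← integral_subtype_comap (measurableSet_coordSimplex _)]
  exact integral_congr_ae (.of_forall fun t => (congrFun (coordDirichlet_comp_val _ _ _ _) t).symm)

/-- The expected value of `h ∘ Flrn` under Pólya distributions of increasing size converges to the
integral of `h` against the Dirichlet density. -/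
theorem integrable_and_tendsto_polya (hυ : υ ≠ 0) {x₀ : X} (hx₀ : x₀ ∈ υ.support) {C : ℝ}
    (hC : ∀ ω : StdSimplex ℝ X, ω.weights.support ⊆ υ.support → |h ω| ≤ C)
    (hh : FaceContinuous υ.support h) :
    Integrable (fun ω => dirichletDensity υ ω * h ω) (simplexLebesgue υ.support x₀) ∧
      Tendsto (fun K : ℕ => validity (polya υ hυ (K + 1)) fun φ => h (flrn φ.1 φ.ne_zero)) atTop
        (𝓝 (∫ ω, dirichletDensity υ ω * h ω ∂(simplexLebesgue υ.support x₀))) := by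
  classical
  rw [integrable_simplexLebesgue_iff, integral_simplexLebesgue]
  set T := υ.support.erase x₀ with hT
  have hx₀T : x₀ ∉ T := Finset.notMem_erase x₀ _
  have hυT : υ.support = insert x₀ T := (Finset.insert_erase hx₀).symm
  obtain ⟨B, hB, hle⟩ := exists_polyaStep_le (h := h) hυ hx₀T hυT hC
  have hlim : ∀ᵐ t : T → ℝ, Tendsto (fun K => polyaStep υ T h K t) atTop
      (𝓝 (coordDirichlet υ x₀ T h t)) := by
    filter_upwards [measure_eq_zero_iff_ae_notMem.1 (volume_sum_eq_one T)] with t ht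
    by_cases hmem : t ∈ coordSimplex T
    · exact tendsto_polyaStep_of_mem hυ hx₀T hυT hh hmem ht
    · exact tendsto_polyaStep_of_notMem (Finset.erase_subset _ _) x₀ hmem
  have hmeas : ∀ K, AEStronglyMeasurable (polyaStep υ T h K) := fun K =>
    integrable_polyaStep.aestronglyMeasurable
  constructor
  · refine hB.mono' (aestronglyMeasurable_of_tendsto_ae _ hmeas hlim) ?_
    filter_upwards [hlim] with t ht
    exact le_of_tendsto ht.norm (.of_forall fun K => hle K t)
  · simp only [← integral_polyaStep (T := T) (h := h) hυ]
    exact tendsto_integral_of_dominated_convergence B hmeas hB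
      (fun K => .of_forall fun t => hle K t) hlim

/-! ### The Dirichlet measure -/

lemma integrable_dirichlet_iff (υ : X →₀ ℕ) (x₀ : X) (h : StdSimplex ℝ X → ℝ) :
    Integrable h (dirichlet υ x₀) ↔
      Integrable (fun ω => dirichletDensity υ ω * h ω) (simplexLebesgue υ.support x₀) := by
  rw [dirichlet, integrable_withDensity_iff_integrable_smul'
    (measurable_dirichletDensity υ).ennreal_ofReal (.of_forall fun _ => ENNReal.ofReal_lt_top)]
  simp only [ENNReal.toReal_ofReal (dirichletDensity_nonneg υ _), smul_eq_mul]

lemma integral_dirichlet (υ : X →₀ ℕ) (x₀ : X) (h : StdSimplex ℝ X → ℝ) :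
    ∫ ω, h ω ∂(dirichlet υ x₀) =
      ∫ ω, dirichletDensity υ ω * h ω ∂(simplexLebesgue υ.support x₀) := by
  rw [dirichlet, integral_withDensity_eq_integral_toReal_smul
    (measurable_dirichletDensity υ).ennreal_ofReal (.of_forall fun _ => ENNReal.ofReal_lt_top)]
  simp only [ENNReal.toReal_ofReal (dirichletDensity_nonneg υ _), smul_eq_mul]

lemma isProbabilityMeasure_dirichlet (hυ : υ ≠ 0) {x₀ : X} (hx₀ : x₀ ∈ υ.support) :
    IsProbabilityMeasure (dirichlet υ x₀) := by
  -- With h = 1 every Pólya expectation is 1, so the density integrates to the limit 1 and no Beta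
  -- integral has to be computed.
  obtain ⟨hint, hlim⟩ := integrable_and_tendsto_polya (h := fun _ => 1) (C := 1) hυ hx₀
    (fun _ _ => by simp) (fun _ _ _ _ _ => tendsto_const_nhds)
  have hone : ∀ K : ℕ, validity (polya υ hυ (K + 1)) (fun _ => 1) = 1 := fun K => by
    rw [validity_polya]
    simpa using sum_polyaWeight υ hυ (K + 1)
  simp only [hone] at hlim
  have h1 := tendsto_nhds_unique hlim tendsto_const_nhds
  simp only [mul_one] at h1 hint
  constructor
  rw [dirichlet, withDensity_apply _ .univ, Measure.restrict_univ,
    ← ofReal_integral_eq_lintegral_ofReal hint (.of_forall (dirichletDensity_nonneg υ)), h1,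
    ENNReal.ofReal_one]

end Urn

theorem mainTheorem7 {X : Type*} [MetricSpace X] (υ : X →₀ ℕ) (hυ : υ ≠ 0)
    (x₀ : X) (hx₀ : x₀ ∈ υ.support) :
    Integrable
        (fun ω => Urn.dirichletDensity υ ω * Urn.kantorovich ω (Urn.flrn υ hυ))
        (Urn.simplexLebesgue υ.support x₀) ∧
      Tendsto
        (fun K : ℕ => Urn.validity (Urn.polya υ hυ (K + 1))
          fun φ => Urn.kantorovich (Urn.flrn φ.1 φ.ne_zero) (Urn.flrn υ hυ))
        atTop
        (𝓝 (∫ ω, Urn.dirichletDensity υ ω * Urn.kantorovich ω (Urn.flrn υ hυ)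
          ∂(Urn.simplexLebesgue υ.support x₀))) ∧
      IsProbabilityMeasure (Urn.dirichlet υ x₀) ∧
      Integrable (fun ω => Urn.kantorovich ω (Urn.flrn υ hυ)) (Urn.dirichlet υ x₀) ∧
      ∫ ω, Urn.dirichletDensity υ ω * Urn.kantorovich ω (Urn.flrn υ hυ)
          ∂(Urn.simplexLebesgue υ.support x₀) =
        ∫ ω, Urn.kantorovich ω (Urn.flrn υ hυ) ∂(Urn.dirichlet υ x₀) := by
  have hρ := Urn.support_flrn_subset υ hυ
  have hD : ∀ x ∈ υ.support, ∀ y ∈ υ.support, dist x y ≤ Metric.diam (υ.support : Set X) :=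
    fun x hx y hy => Metric.dist_le_diam_of_mem υ.support.finite_toSet.isBounded hx hy
  obtain ⟨hint, hlim⟩ := Urn.integrable_and_tendsto_polya
    (h := fun ω => Urn.kantorovich ω (Urn.flrn υ hυ)) hυ hx₀
    (fun ω hω => by
      rw [abs_of_nonneg (Urn.kantorovich_nonneg _ _)]
      exact Urn.kantorovich_le hω hρ hD)
    (fun ω ωs hω hωs hlim => Urn.tendsto_kantorovich hω hωs hρ hlim)
  exact ⟨hint, hlim, Urn.isProbabilityMeasure_dirichlet hυ hx₀,
    (Urn.integrable_dirichlet_iff υ x₀ _).2 hint, (Urn.integral_dirichlet υ x₀ _).symm⟩
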